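/- Let $d\ge 2$, $T>0$, $\sigma>0$, $\delta>0$ and $\xi\in\{1,-1\}$. Consider the Newtonian force $F(x)=\xi x/|x|^d$ on $\mathbb R^d$ and, for $N\in\mathbb N$, its cut-off $F^N(x)=\xi x/\max\{|x|,N^{-\delta}\}^d$, where $F(0)=F^N(0)=0$. On a filtered probability space let $(B_t)_{t\ge0}$ be a $d$-dimensional Brownian motion. Let $(Y_t,W_t)_{0\le t\le T}$ be a (continuous, adapted) solution of the nonlinear SDE $$dY_t=W_t\,dt,\qquad dW_t=(F*\rho_t)(Y_t)\,dt+\sqrt{2\sigma}\,dB_t,\qquad \rho_t=\mathrm{Law}(Y_t),\qquad \mathrm{Law}(Y_0,W_0)=f_0,$$ and for every integer $N\ge e$ let $(Y^N_t,W^N_t)_{0\le t\le T}$ be a solution of the nonlinear SDE with cut-off $$dY^N_t=W^N_t\,dt,\qquad dW^N_t=(F^N*\rho^N_t)(Y^N_t)\,dt+\sqrt{2\sigma}\,dB_t,\qquad \rho^N_t=\mathrm{Law}(Y^N_t),\qquad \mathrm{Law}(Y^N_0,W^N_0)=f_0,$$ driven by the same Brownian motion and with the same initial condition $(Y^N_0,W^N_0)=(Y_0,W_0)$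 almost surely, where $f_0$ is a probability measure on $\mathbb R^d\times\mathbb R^d$. Suppose that $\rho\in L^1(0,T;L^\infty(\mathbb R^d))$, that is, for almost every $t\in(0,T)$ the law $\rho_t$ has a bounded density and $\int_0^T\|\rho_t\|_\infty\,dt<\infty$, and that $\rho^N\in L^1(0,T;L^\infty(\mathbb R^d))$ with $\int_0^T\|\rho^N_t\|_\infty\,dt\le M$ for a constant $M$ independent of $N$. Then there is a constant $C>0$, independent of $p$ and $N$, such that for all integers $N\ge e$ and all real $p\ge1$ $$\mathbb E\Big[\sup_{0\le t\le T}\big(\sqrt{\ln N}\,|Y^N_t-Y_t|+|W^N_t-W_t|\big)^p\Big]^{1/p}\le C\,N^{-\delta}\exp\big(C\sqrt{\ln N}\big).$$ -/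

import Mathlib

open MeasureTheory ProbabilityTheory Set
open scoped ENNReal NNReal

noncomputable section

namespace VPFP

/-- The space `ℝ^d` of positions or velocities, with the Euclidean norm. -/
abbrev E (d : ℕ) : Type := EuclideanSpace ℝ (Fin d)

/-- The Newtonian force `F(x) = ξ x / |x|^d`, with `F(0) = 0`. -/
def force (d : ℕ) (ξ : ℝ) (x : E d) : E d :=
  (ξ / ‖x‖ ^ d) • x

/-- The force with cut-off `F^N(x) = ξ x / (|x| ∨ N^{-δ})^d`, with `F^N(0) = 0`. -/
def cutoffForce (d : ℕ) (ξ δ : ℝ) (N : ℕ) (x : E d) : E d :=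
  (ξ / (max ‖x‖ ((N : ℝ) ^ (-δ))) ^ d) • x

/-- The convolution `(K * ρ)(x) = ∫ K(x - y) ρ(dy)` of a kernel with a measure. -/
def conv {d : ℕ} (K : E d → E d) (ρ : Measure (E d)) (x : E d) : E d :=
  ∫ y, K (x - y) ∂ρ

open scoped Classical in
/-- The norm `‖ρ‖_∞` of a measure `ρ` on `ℝ^d`: the `L^∞` norm of its Lebesgue density, and `∞`
if `ρ` has no density. -/
def densityNorm {d : ℕ} (ρ : Measure (E d)) : ℝ≥0∞ :=
  if ρ ≪ volume then eLpNorm (ρ.rnDeriv volume) ∞ volume else ∞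

/-- The norm `∫_0^T ‖ρ_t‖_∞ dt` in `L^1(0,T;L^∞)` of a family of measures on `ℝ^d`; the family
belongs to `L^1(0,T;L^∞)` when it is finite. For the laws `ρ_t` of a process with almost surely
continuous paths the integrand is lower semicontinuous, hence measurable. -/
def densityNormL1 {d : ℕ} (T : ℝ≥0) (ρ : ℝ≥0 → Measure (E d)) : ℝ≥0∞ :=
  ∫⁻ t in Ioo (0 : ℝ) T, densityNorm (ρ t.toNNReal)

/-- `B` is a standard `d`-dimensional Brownian motion with respect to the filtration `ℱ`. -/
structure IsBrownianMotion {d : ℕ} {Ω : Type*} {mΩ : MeasurableSpace Ω} (P : Measure Ω)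
    (ℱ : Filtration ℝ≥0 mΩ) (B : ℝ≥0 → Ω → E d) : Prop where
  /-- the coordinates are standard real Brownian motions -/
  coord : ∀ i, IsBrownianReal (fun t ω ↦ B t ω i) P
  /-- the coordinate processes are mutually independent -/
  indep_coord : iIndepFun (fun i ω (t : ℝ≥0) ↦ B t ω i) P
  adapted : ∀ t, Measurable[ℱ t] (B t)
  /-- the increments are independent of the past -/
  indep_past : ∀ s t, s ≤ t →
    Indep (ℱ s) (MeasurableSpace.comap (fun ω ↦ B t ω - B s ω) inferInstance) P

/-- `(Y, W)` is a solution on `[0,T]` of the nonlinear SDE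
`dY_t = W_t dt`, `dW_t = (K * ρ_t)(Y_t) dt + √(2σ) dB_t`, `ρ_t = Law(Y_t)`, `Law(Y_0, W_0) = f₀`.
As the noise is additive, the stochastic integral is `√(2σ) (B_t - B_0)`, and `B_0 = 0`. -/
structure IsSolution {d : ℕ} {Ω : Type*} {mΩ : MeasurableSpace Ω} (P : Measure Ω)
    (ℱ : Filtration ℝ≥0 mΩ) (B : ℝ≥0 → Ω → E d) (K : E d → E d) (σ : ℝ)
    (f₀ : Measure (E d × E d)) (T : ℝ≥0) (Y W : ℝ≥0 → Ω → E d) : Prop where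
  adapted_pos : ∀ t ≤ T, Measurable[ℱ t] (Y t)
  adapted_vel : ∀ t ≤ T, Measurable[ℱ t] (W t)
  continuous_pos : ∀ᵐ ω ∂P, ContinuousOn (fun t ↦ Y t ω) (Icc 0 T)
  continuous_vel : ∀ᵐ ω ∂P, ContinuousOn (fun t ↦ W t ω) (Icc 0 T)
  initial : P.map (fun ω ↦ (Y 0 ω, W 0 ω)) = f₀
  integrable_drift : ∀ᵐ ω ∂P, IntervalIntegrable
    (fun s : ℝ ↦ conv K (P.map (Y s.toNNReal)) (Y s.toNNReal ω)) volume 0 T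
  eq_pos : ∀ᵐ ω ∂P, ∀ t ≤ T, Y t ω = Y 0 ω + ∫ s in (0 : ℝ)..t, W s.toNNReal ω
  eq_vel : ∀ᵐ ω ∂P, ∀ t ≤ T, W t ω = W 0 ω
    + (∫ s in (0 : ℝ)..t, conv K (P.map (Y s.toNNReal)) (Y s.toNNReal ω))
    + √(2 * σ) • B t ω

end VPFP

end

/-!
The two processes are driven by the same Brownian motion, and the noise is additive, so it cancels
in the difference `(X, V) = (Y^N - Y, W^N - W)`: pathwise, `X' = V`, and `V'` is the difference of
two force fields. Hence no stochastic analysis is needed, and the difference is bounded by a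
deterministic constant, which bounds all its moments by the same constant.

For the field, write `ε = N^{-δ}` and let `G` be an almost sure bound of `|X_s|`. The convolutions
are expectations over an independent copy of the process, and the pair `(Y_s, Y^N_s)` couples the
two laws, so that the local Lipschitz estimate `norm_truncForce_sub_le` of the truncated force leads
to the convolution of `(|x| ∨ ε)^{-d}` with bounded densities. This kernel is critical: in polar
coordinates its integral over the unit ball is of the order `log (1/ε) = δ log N`. Replacing the
force by its truncation costs `O(ε)`, the integral of `|x|^{1-d}` over the ball of radius `ε`.
Together (`norm_conv_truncForce_sub_conv_force_le_of_coupling`),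
`|V'| ≤ C (1 + ‖ρ_s‖_∞ + ‖ρ^N_s‖_∞) log N * G + C ‖ρ_s‖_∞ N^{-δ}`.

With the weight `ℓ = √(log N)`, a deterministic bound `g` of `Z = ℓ |X| + |V|` gives `|X| ≤ g / ℓ`,
and both `ℓ |X'| ≤ ℓ g` and the main term of `|V'|` are of the order `ℓ g`. Grönwall's inequality for
almost sure bounds (`ae_le_mul_exp_of_forall_bound`) then yields `Z ≤ C N^{-δ} exp (C ℓ)`. It is
proved by Picard iteration from an a priori bound (`exists_ae_bound_sub`), which holds as the fields
of bounded densities are bounded.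

The hypotheses bound a lower Lebesgue integral of `t ↦ ‖ρ_t‖_∞`. That it controls this function
almost everywhere requires measurability, which follows from lower semicontinuity
(`aemeasurable_densityNorm_map`).
-/

namespace VPFP

variable {d : ℕ}

/-! ### The force, its truncation, and their sizes -/

/-- The force `ξ x / (|x| ∨ ε)^d` truncated at distance `ε`. -/
noncomputable def truncForce (d : ℕ) (ξ ε : ℝ) (x : E d) : E d :=
  (ξ / (max ‖x‖ ε) ^ d) • x

/-- The size `|x|^{1-d}` of the Newtonian force. -/
noncomputable def forceSize (d : ℕ) (x : E d) : ℝ := (‖x‖ ^ (d - 1))⁻¹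

/-- The kernel `(|x| ∨ ε)^{-d}`, which controls the local Lipschitz constant of the truncated
force. -/
noncomputable def slopeSize (d : ℕ) (ε : ℝ) (x : E d) : ℝ := ((max ‖x‖ ε) ^ d)⁻¹

theorem measurable_force (ξ : ℝ) : Measurable (force d ξ) := by
  unfold force; fun_prop

theorem measurable_truncForce (ξ ε : ℝ) : Measurable (truncForce d ξ ε) := by
  unfold truncForce; fun_prop

theorem measurable_forceSize : Measurable (forceSize d) := by
  unfold forceSize; fun_prop

theorem measurable_slopeSize (ε : ℝ) : Measurable (slopeSize d ε) := by
  unfold slopeSize; fun_prop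

theorem forceSize_nonneg (x : E d) : 0 ≤ forceSize d x := by
  unfold forceSize; positivity

theorem slopeSize_nonneg {ε : ℝ} (x : E d) : 0 ≤ slopeSize d ε x := by
  unfold slopeSize
  have : 0 ≤ max ‖x‖ ε := le_max_of_le_left (norm_nonneg _)
  positivity

theorem forceSize_eq (hd : 2 ≤ d) {x : E d} (hx : x ≠ 0) :
    forceSize d x = ‖x‖ / ‖x‖ ^ d := by
  obtain ⟨k, rfl⟩ : ∃ k, d = k + 1 := ⟨d - 1, by omega⟩
  have : ‖x‖ ≠ 0 := by simpa using hx
  simp only [forceSize, Nat.add_sub_cancel, pow_succ]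
  field_simp

theorem norm_force_le (hd : 2 ≤ d) {ξ : ℝ} (hξ : |ξ| = 1) (x : E d) :
    ‖force d ξ x‖ ≤ forceSize d x := by
  rcases eq_or_ne x 0 with rfl | hx
  · simpa [force] using forceSize_nonneg (0 : E d)
  · rw [forceSize_eq hd hx, force, norm_smul, norm_div, norm_pow, norm_norm, Real.norm_eq_abs, hξ]
    apply le_of_eq; ring

theorem norm_truncForce_le (hd : 2 ≤ d) {ξ ε : ℝ} (hξ : |ξ| = 1) (x : E d) :
    ‖truncForce d ξ ε x‖ ≤ forceSize d x := by
  rcases eq_or_ne x 0 with rfl | hx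
  · simpa [truncForce] using forceSize_nonneg (0 : E d)
  · have hx' : 0 < ‖x‖ := norm_pos_iff.2 hx
    have hm : 0 < max ‖x‖ ε := lt_max_of_lt_left hx'
    rw [forceSize_eq hd hx, truncForce, norm_smul, norm_div, norm_pow, Real.norm_eq_abs, hξ,
      Real.norm_eq_abs, abs_of_pos hm, one_div, inv_mul_eq_div]
    gcongr
    exact le_max_left _ _

theorem norm_truncForce_sub_force_le (hd : 2 ≤ d) {ξ ε : ℝ} (hξ : |ξ| = 1)
    (x : E d) :
    ‖truncForce d ξ ε x - force d ξ x‖ ≤ (Metric.ball 0 ε).indicator (forceSize d) x := by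
  rcases eq_or_ne x 0 with rfl | hx
  · simpa [truncForce, force] using indicator_nonneg (fun y _ ↦ forceSize_nonneg y) (0 : E d)
  have hx' : 0 < ‖x‖ := norm_pos_iff.2 hx
  rcases le_or_gt ε ‖x‖ with h | h
  · rw [truncForce, force, max_eq_left h]
    simpa using indicator_nonneg (fun y _ ↦ forceSize_nonneg y) x
  · have hmem : x ∈ Metric.ball (0 : E d) ε := by simpa using h
    rw [indicator_of_mem hmem, forceSize_eq hd hx, truncForce, force, max_eq_right h.le, ← sub_smul,
      norm_smul, div_eq_mul_inv, div_eq_mul_inv, ← mul_sub, norm_mul, Real.norm_eq_abs, hξ, one_mul,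
      div_eq_inv_mul, Real.norm_eq_abs, abs_sub_comm]
    have h0 : 0 < ε := hx'.trans h
    have h1 : (ε ^ d)⁻¹ ≤ (‖x‖ ^ d)⁻¹ := by gcongr
    rw [abs_of_nonneg (sub_nonneg.2 h1)]
    gcongr
    have : 0 ≤ (ε ^ d)⁻¹ := by positivity
    linarith

/-- The truncated force is locally Lipschitz, with a constant of the order of its derivative at the
two points. -/
theorem norm_truncForce_sub_le {ξ ε : ℝ} (hξ : |ξ| = 1) (hε : 0 < ε) (x y : E d) :
    ‖truncForce d ξ ε x - truncForce d ξ ε y‖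
      ≤ (d + 1) * (slopeSize d ε x + slopeSize d ε y) * ‖x - y‖ := by
  unfold truncForce slopeSize
  set m := max ‖x‖ ε
  set n := max ‖y‖ ε
  have hm : 0 < m := lt_max_of_lt_right hε
  have hn : 0 < n := lt_max_of_lt_right hε
  have hyn : ‖y‖ ≤ n := le_max_left _ _
  have hmn : |m - n| ≤ ‖x - y‖ :=
    (abs_max_sub_max_le_abs _ _ _).trans (abs_norm_sub_norm_le x y)
  -- splitting off the factor at `y`, the difference of the weights meets `|y| ≤ n`
  have key : n * |(m ^ d)⁻¹ - (n ^ d)⁻¹| ≤ d * ((m ^ d)⁻¹ + (n ^ d)⁻¹) * ‖x - y‖ := by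
    have h1 : |(m ^ d)⁻¹ - (n ^ d)⁻¹| = |m ^ d - n ^ d| * ((m ^ d)⁻¹ * (n ^ d)⁻¹) := by
      rw [inv_sub_inv (by positivity) (by positivity), abs_div, abs_sub_comm,
        abs_of_pos (a := m ^ d * n ^ d) (by positivity), div_eq_mul_inv, mul_inv]
    have h2 := abs_pow_sub_pow_le m n d
    rw [abs_of_pos hm, abs_of_pos hn] at h2
    have h3 : n * max m n ^ (d - 1) * ((m ^ d)⁻¹ * (n ^ d)⁻¹) * d
        ≤ d * ((m ^ d)⁻¹ + (n ^ d)⁻¹) := by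
      rcases Nat.eq_zero_or_pos d with rfl | hd0
      · simp
      rw [mul_comm]
      gcongr
      have h4 : n * max m n ^ (d - 1) ≤ max m n ^ d := by
        conv_rhs => rw [← Nat.sub_add_cancel hd0, pow_succ']
        gcongr
        exact le_max_right _ _
      have h5 : max m n ^ d ≤ m ^ d + n ^ d := by
        rcases max_choice m n with h | h <;> rw [h] <;> simp <;> positivity
      calc n * max m n ^ (d - 1) * ((m ^ d)⁻¹ * (n ^ d)⁻¹)
          ≤ (m ^ d + n ^ d) * ((m ^ d)⁻¹ * (n ^ d)⁻¹) := by gcongr; exact h4.trans h5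
        _ = (m ^ d)⁻¹ + (n ^ d)⁻¹ := by field_simp; ring
    calc n * |(m ^ d)⁻¹ - (n ^ d)⁻¹|
        ≤ n * ((|m - n| * d * max m n ^ (d - 1)) * ((m ^ d)⁻¹ * (n ^ d)⁻¹)) := by
          rw [h1]; gcongr
      _ = (n * max m n ^ (d - 1) * ((m ^ d)⁻¹ * (n ^ d)⁻¹) * d) * |m - n| := by ring
      _ ≤ d * ((m ^ d)⁻¹ + (n ^ d)⁻¹) * ‖x - y‖ := by gcongr
  have hsplit : (ξ / m ^ d) • x - (ξ / n ^ d) • y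
      = ξ • ((m ^ d)⁻¹ • (x - y) + ((m ^ d)⁻¹ - (n ^ d)⁻¹) • y) := by
    simp only [div_eq_mul_inv, mul_smul]
    rw [← smul_sub]
    congr 1
    module
  have hle : 0 ≤ (n ^ d)⁻¹ * ‖x - y‖ := by positivity
  calc ‖(ξ / m ^ d) • x - (ξ / n ^ d) • y‖
      ≤ (m ^ d)⁻¹ * ‖x - y‖ + |(m ^ d)⁻¹ - (n ^ d)⁻¹| * ‖y‖ := by
        rw [hsplit, norm_smul, Real.norm_eq_abs, hξ, one_mul]
        refine (norm_add_le _ _).trans_eq ?_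
        rw [norm_smul, norm_smul, Real.norm_eq_abs, Real.norm_eq_abs,
          abs_of_pos (a := (m ^ d)⁻¹) (by positivity)]
    _ ≤ (m ^ d)⁻¹ * ‖x - y‖ + n * |(m ^ d)⁻¹ - (n ^ d)⁻¹| := by
        rw [mul_comm n]; gcongr
    _ ≤ (m ^ d)⁻¹ * ‖x - y‖ + d * ((m ^ d)⁻¹ + (n ^ d)⁻¹) * ‖x - y‖ := by gcongr
    _ ≤ (d + 1) * ((m ^ d)⁻¹ + (n ^ d)⁻¹) * ‖x - y‖ := by linarith

/-! ### Radial integrals -/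

/-- The surface measure `d |B(0,1)|` of the unit sphere of `ℝ^d`. -/
noncomputable def sphereArea (d : ℕ) : ℝ := d * (volume : Measure (E d)).real (Metric.ball 0 1)

theorem sphereArea_nonneg : 0 ≤ sphereArea d := by unfold sphereArea; positivity

/-- Polar coordinates for a radial function on a ball. -/
theorem setIntegral_ball_fun_norm (hd : 2 ≤ d) (f : ℝ → ℝ) (r : ℝ) :
    ∫ x in Metric.ball (0 : E d) r, f ‖x‖ = sphereArea d * ∫ y in Ioo 0 r, y ^ (d - 1) * f y := by
  have : Nonempty (Fin d) := ⟨⟨0, by omega⟩⟩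
  have h := integral_fun_norm_addHaar (volume : Measure (E d)) ((Iio r).indicator f)
  have h1 : (fun x : E d ↦ (Iio r).indicator f ‖x‖)
      = (Metric.ball 0 r).indicator (fun x ↦ f ‖x‖) := by
    ext x; simp [indicator]
  have h2 : (fun y : ℝ ↦ y ^ (Module.finrank ℝ (E d) - 1) • (Iio r).indicator f y)
      = (Iio r).indicator (fun y ↦ y ^ (d - 1) * f y) := by
    ext x; simp [indicator]
  rw [h1, h2, integral_indicator measurableSet_ball, setIntegral_indicator measurableSet_Iio] at h
  rw [h, Ioi_inter_Iio]
  simp [sphereArea, mul_assoc]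

theorem integrableOn_forceSize (hd : 2 ≤ d) (r : ℝ) :
    IntegrableOn (forceSize d) (Metric.ball 0 r) := by
  have : Nonempty (Fin d) := ⟨⟨0, by omega⟩⟩
  refine (integrableOn_fun_norm_addHaar (volume : Measure (E d))
    (f := fun y ↦ (y ^ (d - 1))⁻¹)).2 ?_
  rw [integrableOn_congr_fun (g := fun _ ↦ (1 : ℝ)) _ measurableSet_Ioo]
  · simp
  · intro y hy
    have : y ≠ 0 := hy.1.ne'
    simp [this]

theorem setIntegral_forceSize (hd : 2 ≤ d) {r : ℝ} (hr : 0 ≤ r) :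
    ∫ x in Metric.ball 0 r, forceSize d x = sphereArea d * r := by
  unfold forceSize
  rw [setIntegral_ball_fun_norm hd (fun y ↦ (y ^ (d - 1))⁻¹),
    setIntegral_congr_fun (g := fun _ ↦ (1 : ℝ)) measurableSet_Ioo]
  · simp [hr]
  · intro y hy
    have : y ≠ 0 := hy.1.ne'
    simp [this]

theorem integrableOn_slopeSize {ε : ℝ} (hε : 0 < ε) (r : ℝ) :
    IntegrableOn (slopeSize d ε) (Metric.ball 0 r) := by
  refine Measure.integrableOn_of_bounded (M := (ε ^ d)⁻¹) measure_ball_lt_top.ne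
    (measurable_slopeSize ε).aestronglyMeasurable (ae_of_all _ fun x ↦ ?_)
  rw [Real.norm_of_nonneg (slopeSize_nonneg x), slopeSize]
  gcongr
  exact le_max_right _ _

/-- The critical kernel is not integrable at the origin: truncation costs a logarithm. -/
theorem setIntegral_slopeSize_le (hd : 2 ≤ d) {ε : ℝ} (hε : 0 < ε) (hε1 : ε ≤ 1) :
    ∫ x in Metric.ball 0 1, slopeSize d ε x ≤ sphereArea d * (1 + Real.log ε⁻¹) := by
  unfold slopeSize
  rw [setIntegral_ball_fun_norm hd (fun y ↦ ((max y ε) ^ d)⁻¹)]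
  refine mul_le_mul_of_nonneg_left ?_ sphereArea_nonneg
  have hc : Continuous fun y : ℝ ↦ y ^ (d - 1) * ((max y ε) ^ d)⁻¹ := by
    have : ∀ y : ℝ, (max y ε) ^ d ≠ 0 := fun y ↦ (pow_pos (lt_max_of_lt_right hε) _).ne'
    fun_prop (disch := exact this _)
  rw [← integral_Ioc_eq_integral_Ioo, ← intervalIntegral.integral_of_le zero_le_one,
    ← intervalIntegral.integral_add_adjacent_intervals (b := ε) (hc.intervalIntegrable _ _)
      (hc.intervalIntegrable _ _)]
  obtain ⟨k, rfl⟩ : ∃ k, d = k + 1 := ⟨d - 1, by omega⟩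
  simp only [Nat.add_sub_cancel] at hc ⊢
  gcongr
  · calc ∫ y in (0 : ℝ)..ε, y ^ k * ((max y ε) ^ (k + 1))⁻¹ ≤ ∫ y in (0 : ℝ)..ε, ε⁻¹ := by
          refine intervalIntegral.integral_mono_on hε.le (hc.intervalIntegrable _ _) (by simp) ?_
          intro y hy
          rw [max_eq_right hy.2]
          calc y ^ k * (ε ^ (k + 1))⁻¹ ≤ ε ^ k * (ε ^ (k + 1))⁻¹ := by
                have := hy.1; have := hy.2; gcongr
            _ = ε⁻¹ := by rw [pow_succ]; field_simp
      _ = 1 := by simp [hε.ne']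
  · have : ∫ y in ε..1, y ^ k * ((max y ε) ^ (k + 1))⁻¹ = ∫ y in ε..1, y⁻¹ := by
      refine intervalIntegral.integral_congr fun y hy ↦ ?_
      rw [uIcc_of_le hε1] at hy
      have : 0 < y := hε.trans_le hy.1
      simp only [max_eq_left hy.1, pow_succ]
      field_simp
    rw [this, integral_inv_of_pos hε one_pos, one_div]

/-! ### Convolution with bounded densities -/

/-- Convolution of a nonnegative kernel, bounded away from the origin, with a probability measure
of bounded density. -/
theorem integrable_comp_sub_of_le_smul_volume {ρ : Measure (E d)} [IsProbabilityMeasure ρ] {c : ℝ≥0}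
    (hρ : ρ ≤ c • volume) {k : E d → ℝ} (hk : Measurable k) (hk0 : ∀ x, 0 ≤ k x) {r b : ℝ}
    (hint : IntegrableOn k (Metric.ball 0 r)) (hb : 0 ≤ b)
    (hkb : ∀ x, x ∉ Metric.ball 0 r → k x ≤ b)
    (x : E d) :
    Integrable (fun y ↦ k (x - y)) ρ ∧
      ∫ y, k (x - y) ∂ρ ≤ b + c * ∫ z in Metric.ball 0 r, k z := by
  have hm : Measurable fun y : E d ↦ x - y := by fun_prop
  -- the reflected translate `ν` of `ρ` has the same bound on its density
  set ν := ρ.map fun y ↦ x - y with hν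
  have : IsProbabilityMeasure ν := Measure.isProbabilityMeasure_map hm.aemeasurable
  have hle : ν ≤ c • volume := by
    refine (Measure.map_mono hρ hm).trans_eq ?_
    rw [Measure.map_smul, (Measure.measurePreserving_sub_left volume x).map_eq]
  have hball : Integrable k ((c • volume : Measure (E d)).restrict (Metric.ball 0 r)) := by
    rw [Measure.restrict_smul]
    exact hint.integrable.smul_measure_nnreal
  have h1 : IntegrableOn k (Metric.ball 0 r) ν :=
    hball.mono_measure (Measure.restrict_mono_measure hle _)
  have hbc : ∀ᵐ z ∂ν.restrict (Metric.ball 0 r)ᶜ, ‖k z‖ ≤ b := by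
    filter_upwards [ae_restrict_mem measurableSet_ball.compl] with z hz
    rw [Real.norm_of_nonneg (hk0 z)]
    exact hkb z hz
  have h2 : IntegrableOn k (Metric.ball 0 r)ᶜ ν :=
    Measure.integrableOn_of_bounded (measure_ne_top _ _) hk.aestronglyMeasurable hbc
  have hνint : Integrable k ν := by
    rw [← integrableOn_univ, ← union_compl_self (Metric.ball (0 : E d) r)]
    exact h1.union h2
  refine ⟨(integrable_map_measure hk.aestronglyMeasurable hm.aemeasurable).1 hνint, ?_⟩
  rw [← integral_map hm.aemeasurable hk.aestronglyMeasurable, ← hν,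
    ← integral_add_compl (measurableSet_ball (x := (0 : E d)) (ε := r)) hνint, add_comm]
  gcongr ?_ + ?_
  · have h := norm_setIntegral_le_of_norm_le_const_ae' (measure_lt_top ν (Metric.ball 0 r)ᶜ)
      ((ae_restrict_iff' measurableSet_ball.compl).1 hbc)
    exact (le_abs_self _).trans (h.trans (mul_le_of_le_one_right hb measureReal_le_one))
  · refine (integral_mono_measure (Measure.restrict_mono_measure hle _)
      (ae_of_all _ hk0) hball).trans_eq ?_
    rw [Measure.restrict_smul, integral_smul_nnreal_measure]
    rfl

section BoundedDensity

variable {ρ : Measure (E d)} [IsProbabilityMeasure ρ] {c : ℝ≥0}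

theorem integrable_forceSize_comp_sub (hd : 2 ≤ d) (hρ : ρ ≤ c • volume) (x : E d) :
    Integrable (fun y ↦ forceSize d (x - y)) ρ ∧
      ∫ y, forceSize d (x - y) ∂ρ ≤ 1 + c * sphereArea d := by
  have h := integrable_comp_sub_of_le_smul_volume hρ measurable_forceSize forceSize_nonneg
    (integrableOn_forceSize hd 1) zero_le_one (fun z hz ↦ ?_) x
  · rwa [setIntegral_forceSize hd zero_le_one, mul_one] at h
  · have : 1 ≤ ‖z‖ := by simpa using hz
    exact inv_le_one_of_one_le₀ (one_le_pow₀ this)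

theorem integrable_slopeSize_comp_sub (hd : 2 ≤ d) (hρ : ρ ≤ c • volume) {ε : ℝ} (hε : 0 < ε)
    (hε1 : ε ≤ 1) (x : E d) :
    Integrable (fun y ↦ slopeSize d ε (x - y)) ρ ∧
      ∫ y, slopeSize d ε (x - y) ∂ρ ≤ 1 + c * (sphereArea d * (1 + Real.log ε⁻¹)) := by
  have h := integrable_comp_sub_of_le_smul_volume hρ (measurable_slopeSize ε) slopeSize_nonneg
    (integrableOn_slopeSize hε 1) zero_le_one (fun z hz ↦ ?_) x
  · refine ⟨h.1, h.2.trans ?_⟩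
    gcongr
    exact setIntegral_slopeSize_le hd hε hε1
  · have : 1 ≤ ‖z‖ := by simpa using hz
    exact inv_le_one_of_one_le₀ (one_le_pow₀ (this.trans (le_max_left _ _)))

/-- A kernel of the size of the Newtonian force has a bounded convolution with a bounded
density. -/
theorem integrable_and_norm_conv_le (hd : 2 ≤ d) (hρ : ρ ≤ c • volume) {K : E d → E d}
    (hK : Measurable K) (hKle : ∀ z, ‖K z‖ ≤ forceSize d z) (x : E d) :
    Integrable (fun y ↦ K (x - y)) ρ ∧ ‖conv K ρ x‖ ≤ 1 + c * sphereArea d := by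
  have h := integrable_forceSize_comp_sub hd hρ x
  refine ⟨h.1.mono' (hK.comp (by fun_prop : Measurable fun y ↦ x - y)).aestronglyMeasurable
    (ae_of_all _ fun y ↦ hKle _), ?_⟩
  exact (norm_integral_le_of_norm_le h.1 (ae_of_all _ fun y ↦ hKle _)).trans h.2

/-- The truncation changes the field of a bounded density by `O(ε)`. -/
theorem norm_conv_truncForce_sub_conv_force_le (hd : 2 ≤ d) {ξ ε : ℝ} (hξ : |ξ| = 1) (hε : 0 < ε)
    (hρ : ρ ≤ c • volume) (x : E d) :
    ‖conv (truncForce d ξ ε) ρ x - conv (force d ξ) ρ x‖ ≤ c * (sphereArea d * ε) := by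
  have h1 := (integrable_and_norm_conv_le hd hρ (measurable_truncForce ξ ε)
    (norm_truncForce_le hd hξ) x).1
  have h2 := (integrable_and_norm_conv_le hd hρ (measurable_force ξ) (norm_force_le hd hξ) x).1
  have h := integrable_comp_sub_of_le_smul_volume (b := 0) (r := ε) hρ
    (measurable_forceSize.indicator (measurableSet_ball (x := (0 : E d)) (ε := ε)))
    (indicator_nonneg fun y _ ↦ forceSize_nonneg y)
    ((integrableOn_forceSize hd ε).congr_fun
      (fun z hz ↦ (indicator_of_mem hz _).symm) measurableSet_ball) le_rfl
    (fun z hz ↦ (indicator_of_notMem hz _).le) x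
  rw [setIntegral_congr_fun measurableSet_ball fun z hz ↦ indicator_of_mem hz _,
    setIntegral_forceSize hd hε.le, zero_add] at h
  rw [conv, conv, ← integral_sub h1 h2]
  exact (norm_integral_le_of_norm_le h.1
    (ae_of_all _ fun y ↦ norm_truncForce_sub_force_le hd hξ _)).trans h.2

/-- Stability of the force field: two fields generated by bounded densities and evaluated at two
points differ by the size `G` of the displacement, up to the logarithm of the truncation, plus the
error `O(ε)` of the truncation. The displacement of the densities is measured by an
essentially bounded coupling. -/
theorem norm_conv_truncForce_sub_conv_force_le_of_coupling (hd : 2 ≤ d) {ξ ε : ℝ} (hξ : |ξ| = 1)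
    (hε : 0 < ε) (hε1 : ε ≤ 1) {Ω : Type*} {mΩ : MeasurableSpace Ω} {P : Measure Ω}
    [IsProbabilityMeasure P] {X X' : Ω → E d} (hX : Measurable X) (hX' : Measurable X')
    {c c' : ℝ≥0} (hc : P.map X ≤ c • volume) (hc' : P.map X' ≤ c' • volume) {G : ℝ}
    (hG : ∀ᵐ ω ∂P, ‖X' ω - X ω‖ ≤ G) {x x' : E d} (hx : ‖x' - x‖ ≤ G) :
    ‖conv (truncForce d ξ ε) (P.map X') x' - conv (force d ξ) (P.map X) x‖
      ≤ (d + 1) * (2 + (c + c') * (sphereArea d * (1 + Real.log ε⁻¹))) * (2 * G)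
        + c * (sphereArea d * ε) := by
  have : IsProbabilityMeasure (P.map X) := Measure.isProbabilityMeasure_map hX.aemeasurable
  have : IsProbabilityMeasure (P.map X') := Measure.isProbabilityMeasure_map hX'.aemeasurable
  have hF := measurable_truncForce (d := d) ξ ε
  have hL := measurable_slopeSize (d := d) ε
  have i1 := (integrable_and_norm_conv_le hd hc hF (norm_truncForce_le hd hξ) x).1
  have i1' := (integrable_and_norm_conv_le hd hc' hF (norm_truncForce_le hd hξ) x').1
  have i2 := integrable_slopeSize_comp_sub hd hc hε hε1 x
  have i2' := integrable_slopeSize_comp_sub hd hc' hε hε1 x'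
  have hm (z : E d) : Measurable fun y ↦ truncForce d ξ ε (z - y) := by fun_prop
  have hl (z : E d) : Measurable fun y ↦ slopeSize d ε (z - y) := by fun_prop
  rw [integrable_map_measure (hm _).aestronglyMeasurable hX.aemeasurable, Function.comp_def] at i1
  rw [integrable_map_measure (hm _).aestronglyMeasurable hX'.aemeasurable, Function.comp_def] at i1'
  rw [integrable_map_measure (hl _).aestronglyMeasurable hX.aemeasurable,
    integral_map hX.aemeasurable (hl _).aestronglyMeasurable, Function.comp_def] at i2
  rw [integrable_map_measure (hl _).aestronglyMeasurable hX'.aemeasurable,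
    integral_map hX'.aemeasurable (hl _).aestronglyMeasurable, Function.comp_def] at i2'
  have hG0 : 0 ≤ G := (norm_nonneg _).trans hx
  have e1 : conv (truncForce d ξ ε) (P.map X') x' - conv (truncForce d ξ ε) (P.map X) x
      = ∫ ω, (truncForce d ξ ε (x' - X' ω) - truncForce d ξ ε (x - X ω)) ∂P := by
    rw [integral_sub i1' i1, conv, conv, integral_map hX.aemeasurable (hm _).aestronglyMeasurable,
      integral_map hX'.aemeasurable (hm _).aestronglyMeasurable]
  have e2 : ‖conv (truncForce d ξ ε) (P.map X') x' - conv (truncForce d ξ ε) (P.map X) x‖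
      ≤ (d + 1) * (2 + (c + c') * (sphereArea d * (1 + Real.log ε⁻¹))) * (2 * G) := by
    rw [e1]
    refine (norm_integral_le_of_norm_le (g := fun ω ↦ (d + 1) *
      (slopeSize d ε (x' - X' ω) + slopeSize d ε (x - X ω)) * (2 * G))
      (((i2'.1.add i2.1).const_mul _).mul_const _) ?_).trans ?_
    · filter_upwards [hG] with ω hω
      refine (norm_truncForce_sub_le hξ hε _ _).trans ?_
      have h0 := slopeSize_nonneg (ε := ε) (x - X ω)
      have h0' := slopeSize_nonneg (ε := ε) (x' - X' ω)
      gcongr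
      calc ‖x' - X' ω - (x - X ω)‖ = ‖(x' - x) - (X' ω - X ω)‖ := by congr 1; abel
        _ ≤ ‖x' - x‖ + ‖X' ω - X ω‖ := norm_sub_le _ _
        _ ≤ 2 * G := by linarith
    · rw [integral_mul_const, integral_const_mul, integral_add i2'.1 i2.1]
      have h := (add_le_add i2'.2 i2.2).trans_eq (b := _ + _)
        (c := 2 + (c + c') * (sphereArea d * (1 + Real.log ε⁻¹))) (by ring)
      exact mul_le_mul_of_nonneg_right (mul_le_mul_of_nonneg_left h (by positivity)) (by positivity)
  calc _ ≤ ‖conv (truncForce d ξ ε) (P.map X') x' - conv (truncForce d ξ ε) (P.map X) x‖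
        + ‖conv (truncForce d ξ ε) (P.map X) x - conv (force d ξ) (P.map X) x‖ :=
        norm_sub_le_norm_sub_add_norm_sub _ _ _
    _ ≤ _ := add_le_add e2 (norm_conv_truncForce_sub_conv_force_le hd hξ hε hc x)

end BoundedDensity

/-! ### The density norm along a continuous process -/

theorem le_densityNorm_smul_volume {ρ : Measure (E d)} [IsFiniteMeasure ρ]
    (h : densityNorm ρ ≠ ∞) : ρ ≤ densityNorm ρ • volume := by
  unfold densityNorm at h ⊢
  split_ifs at h ⊢ with hac
  swap
  · exact absurd rfl h
  refine Measure.le_iff.2 fun s _ ↦ ?_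
  conv_lhs => rw [← Measure.withDensity_rnDeriv_eq ρ volume hac]
  rw [withDensity_apply' _ s, Measure.smul_apply, smul_eq_mul, ← setLIntegral_const]
  refine lintegral_mono_ae (ae_restrict_of_ae ?_)
  rw [eLpNorm_exponent_top]
  exact ae_le_eLpNormEssSup (f := ρ.rnDeriv volume)

/-- By outer regularity of the Lebesgue measure, the density is bounded as soon as it is bounded in
the mean on open sets of finite volume. -/
theorem densityNorm_le_of_forall_isOpen {ρ : Measure (E d)} [IsFiniteMeasure ρ] {c : ℝ≥0}
    (h : ∀ U, IsOpen U → volume U < ∞ → ρ U ≤ c * volume U) : densityNorm ρ ≤ c := by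
  have hle (s : Set (E d)) (hs : volume s < ∞) : ρ s ≤ c * volume s := by
    rcases eq_or_ne c 0 with rfl | hc
    · obtain ⟨U, hsU, hU, hlt⟩ := s.exists_isOpen_lt_of_lt _ hs
      simpa using (measure_mono hsU).trans (h U hU hlt)
    have hc' : (c : ℝ≥0∞) ≠ 0 := by simpa using hc
    rw [← ENNReal.inv_mul_le_iff hc' ENNReal.coe_ne_top]
    refine le_of_forall_gt fun r hr ↦ ?_
    obtain ⟨U, hsU, hU, hlt⟩ := s.exists_isOpen_lt_of_lt _ hr
    refine lt_of_le_of_lt ?_ hlt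
    rw [ENNReal.inv_mul_le_iff hc' ENNReal.coe_ne_top]
    by_cases hfin : volume U = ∞
    · simp [hfin, hc]
    · exact (measure_mono hsU).trans (h U hU (lt_top_iff_ne_top.2 hfin))
  have hac : ρ ≪ volume := fun s hs ↦ by simpa [hs] using hle s (by simp [hs])
  unfold densityNorm
  rw [if_pos hac, eLpNorm_exponent_top]
  refine eLpNormEssSup_le_of_ae_enorm_bound ?_
  simp only [enorm_eq_self]
  refine ae_le_of_forall_setLIntegral_le_of_sigmaFinite (Measure.measurable_rnDeriv _ _)
    fun s _ hs ↦ ?_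
  rw [setLIntegral_const]
  exact (Measure.setLIntegral_rnDeriv_le s).trans (hle s hs)

theorem densityNorm_eq_iSup (ρ : Measure (E d)) [IsFiniteMeasure ρ] :
    densityNorm ρ = ⨆ U : {U : Set (E d) // IsOpen U ∧ 0 < volume U ∧ volume U < ∞},
      (volume U.1)⁻¹ * ρ U.1 := by
  refine le_antisymm ?_ (iSup_le fun ⟨U, hU, h0, hfin⟩ ↦ ?_)
  · set S := ⨆ U : {U : Set (E d) // IsOpen U ∧ 0 < volume U ∧ volume U < ∞},
      (volume U.1)⁻¹ * ρ U.1 with hS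
    by_cases htop : S = ∞
    · rw [htop]; exact le_top
    rw [← ENNReal.coe_toNNReal htop]
    refine densityNorm_le_of_forall_isOpen fun U hU hfin ↦ ?_
    rcases eq_or_ne (volume U) 0 with h0 | h0
    · simp [(hU.measure_eq_zero_iff volume).1 h0]
    · have := le_iSup (fun U : {U : Set (E d) // IsOpen U ∧ 0 < volume U ∧ volume U < ∞} ↦
        (volume U.1)⁻¹ * ρ U.1) ⟨U, hU, pos_iff_ne_zero.2 h0, hfin⟩
      rw [← hS, ENNReal.inv_mul_le_iff h0 hfin.ne] at this
      rwa [ENNReal.coe_toNNReal htop, mul_comm]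
  · by_cases htop : densityNorm ρ = ∞
    · rw [htop]; exact le_top
    · rw [ENNReal.inv_mul_le_iff h0.ne' hfin.ne, mul_comm]
      exact le_densityNorm_smul_volume htop U

/-- The law of a continuous process charges an open set lower semicontinuously in time. -/
theorem lowerSemicontinuous_map_apply {Ω X : Type*} {mΩ : MeasurableSpace Ω} {P : Measure Ω}
    [TopologicalSpace X] [MeasurableSpace X] [OpensMeasurableSpace X] {Z : ℝ → Ω → X}
    (hZ : ∀ t, Measurable (Z t)) (hc : ∀ᵐ ω ∂P, Continuous fun t ↦ Z t ω) {U : Set X}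
    (hU : IsOpen U) : LowerSemicontinuous fun t ↦ P.map (Z t) U := by
  rw [lowerSemicontinuous_iff_le_liminf]
  intro t
  have h (s : ℝ) : P.map (Z s) U = ∫⁻ ω, U.indicator 1 (Z s ω) ∂P := by
    rw [Measure.map_apply (hZ s) hU.measurableSet,
      ← lintegral_indicator_one (hZ s hU.measurableSet)]
    rfl
  simp only [h]
  refine (lintegral_mono_ae ?_).trans (lintegral_liminf_le fun s ↦
    (measurable_one.indicator hU.measurableSet).comp (hZ s))
  filter_upwards [hc] with ω hω
  have := (hU.lowerSemicontinuous_indicator (zero_le_one (α := ℝ≥0∞))).comp hω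
  exact lowerSemicontinuousAt_iff_le_liminf.1 (this t)

/-- For a continuous process, the norm of the density of the law is a measurable function of
time. -/
theorem aemeasurable_densityNorm_map {Ω : Type*} {mΩ : MeasurableSpace Ω} {P : Measure Ω}
    [IsProbabilityMeasure P] {T : ℝ≥0} {Y : ℝ≥0 → Ω → E d} (hY : ∀ t ≤ T, Measurable (Y t))
    (hc : ∀ᵐ ω ∂P, ContinuousOn (fun t ↦ Y t ω) (Icc 0 T)) :
    AEMeasurable (fun t : ℝ ↦ densityNorm (P.map (Y t.toNNReal)))
      (volume.restrict (Ioo (0 : ℝ) T)) := by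
  -- freezing the process at time `T` makes it continuous on the whole line
  set Z : ℝ → Ω → E d := fun t ↦ Y (min t.toNNReal T) with hZdef
  have hZ (t : ℝ) : Measurable (Z t) := hY _ (min_le_right _ _)
  have hZc : ∀ᵐ ω ∂P, Continuous fun t ↦ Z t ω := by
    filter_upwards [hc] with ω hω
    exact hω.comp_continuous (by fun_prop) fun t ↦ ⟨zero_le, min_le_right _ _⟩
  have hprob (t : ℝ) : IsProbabilityMeasure (P.map (Z t)) :=
    Measure.isProbabilityMeasure_map (hZ t).aemeasurable
  have hlsc : LowerSemicontinuous fun t ↦ densityNorm (P.map (Z t)) := by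
    simp only [densityNorm_eq_iSup]
    refine lowerSemicontinuous_iSup fun ⟨U, hU, h0, _⟩ ↦ ?_
    exact (ENNReal.continuous_const_mul (ENNReal.inv_ne_top.2 h0.ne')).comp_lowerSemicontinuous
      (lowerSemicontinuous_map_apply hZ hZc hU) fun _ _ h ↦ by dsimp only; gcongr
  refine hlsc.measurable.aemeasurable.congr ?_
  filter_upwards [ae_restrict_mem measurableSet_Ioo] with t ht
  have : t.toNNReal ≤ T := Real.toNNReal_le_iff_le_coe.2 ht.2.le
  simp [Z, min_eq_left this]

/-! ### Grönwall's inequality for almost sure bounds -/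

/-- The chain rule for the powers of the primitive of an integrable function. -/
theorem integral_mul_primitive_pow {a : ℝ → ℝ} {T : ℝ} (ha : IntervalIntegrable a volume 0 T)
    (n : ℕ) :
    ∫ s in (0 : ℝ)..T, a s * (∫ r in (0 : ℝ)..s, a r) ^ n
      = (∫ r in (0 : ℝ)..T, a r) ^ (n + 1) / (n + 1) := by
  have hac : AbsolutelyContinuousOnInterval (fun s ↦ ∫ r in (0 : ℝ)..s, a r) 0 T :=
    ha.absolutelyContinuousOnInterval_intervalIntegral left_mem_uIcc
  have hpow (k : ℕ) :
      AbsolutelyContinuousOnInterval (fun s ↦ (∫ r in (0 : ℝ)..s, a r) ^ (k + 1)) 0 T := by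
    induction k with
    | zero => simpa using hac
    | succ k ih => simpa only [pow_succ _ (k + 1)] using ih.fun_mul hac
  have h := (hpow n).integral_deriv_eq_sub
  rw [intervalIntegral.integral_same, zero_pow n.succ_ne_zero, sub_zero] at h
  have hcongr : ∫ s in (0 : ℝ)..T, deriv (fun s ↦ (∫ r in (0 : ℝ)..s, a r) ^ (n + 1)) s
      = ∫ s in (0 : ℝ)..T, (n + 1) * (a s * (∫ r in (0 : ℝ)..s, a r) ^ n) := by
    refine intervalIntegral.integral_congr_ae ?_
    filter_upwards [ha.ae_hasDerivAt_integral] with s hs hsT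
    rw [((hs (uIoc_subset_uIcc hsT) 0 left_mem_uIcc).fun_pow (n + 1)).deriv]
    simp; ring
  rw [← h, hcongr, intervalIntegral.integral_const_mul]
  field_simp

/-- Grönwall's inequality for almost sure bounds of a process by deterministic functions. A bound
`Z ≤ g` may be improved to `Z ≤ b + ∫ a g`; the iteration of this step converges to
`b exp (∫ a)`. The coefficient `a` is only integrable, and no regularity of the smallest
deterministic bound is needed. -/
theorem ae_le_mul_exp_of_forall_bound {Ω : Type*} {mΩ : MeasurableSpace Ω} {P : Measure Ω} {T : ℝ}
    {Z : ℝ → Ω → ℝ} {a : ℝ → ℝ} (ha : IntervalIntegrable a volume 0 T) (ha0 : ∀ t, 0 ≤ a t)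
    {b K : ℝ} (hb : 0 ≤ b) (hK : ∀ᵐ ω ∂P, ∀ t ∈ Icc 0 T, Z t ω ≤ K)
    (hstep : ∀ g : ℝ → ℝ, ContinuousOn g (Icc 0 T) →
      (∀ᵐ ω ∂P, ∀ t ∈ Icc 0 T, Z t ω ≤ g t) →
      ∀ᵐ ω ∂P, ∀ t ∈ Icc 0 T, Z t ω ≤ b + ∫ s in (0 : ℝ)..t, a s * g s) :
    ∀ᵐ ω ∂P, ∀ t ∈ Icc 0 T, Z t ω ≤ b * Real.exp (∫ s in (0 : ℝ)..t, a s) := by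
  rcases lt_or_ge T 0 with hT | hT
  · simp [hT]
  set A : ℝ → ℝ := fun t ↦ ∫ s in (0 : ℝ)..t, a s with hA
  have haint {t : ℝ} (ht : t ∈ Icc 0 T) : IntervalIntegrable a volume 0 t :=
    ha.mono_set (by rw [uIcc_of_le ht.1, uIcc_of_le hT]; exact Icc_subset_Icc_right ht.2)
  have hAc : ContinuousOn A (Icc 0 T) := by
    have := (ha.absolutelyContinuousOnInterval_intervalIntegral left_mem_uIcc).continuousOn
    rwa [uIcc_of_le hT] at this
  have hA0 {t : ℝ} (ht : t ∈ Icc 0 T) : 0 ≤ A t :=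
    intervalIntegral.integral_nonneg ht.1 fun s _ ↦ ha0 s
  -- the Picard iterates of the constant bound `K`
  set g : ℕ → ℝ → ℝ := fun n t ↦
    b * ∑ k ∈ Finset.range n, A t ^ k / k.factorial + K * (A t ^ n / n.factorial) with hg
  have hgc (n : ℕ) : ContinuousOn (g n) (Icc 0 T) := by fun_prop
  have hiter (n : ℕ) : ∀ᵐ ω ∂P, ∀ t ∈ Icc 0 T, Z t ω ≤ g n t := by
    induction n with
    | zero => simpa [hg] using hK
    | succ n ih =>
      filter_upwards [hstep _ (hgc n) ih] with ω hω t ht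
      refine (hω t ht).trans_eq ?_
      have hAct : ContinuousOn A (uIcc 0 t) := by
        rw [uIcc_of_le ht.1]; exact hAc.mono (Icc_subset_Icc_right ht.2)
      have hi (k : ℕ) : IntervalIntegrable (fun s ↦ a s * (A s ^ k / k.factorial)) volume 0 t :=
        (haint ht).mul_continuousOn (by fun_prop)
      have hterm (k : ℕ) : ∫ s in (0 : ℝ)..t, a s * (A s ^ k / k.factorial)
          = A t ^ (k + 1) / (k + 1).factorial := by
        simp only [← mul_div_assoc]
        rw [intervalIntegral.integral_div, integral_mul_primitive_pow (haint ht), div_div,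
          Nat.factorial_succ]
        push_cast
        rfl
      have hexpand (s : ℝ) : a s * g n s = b * ∑ k ∈ Finset.range n, a s * (A s ^ k / k.factorial)
          + K * (a s * (A s ^ n / n.factorial)) := by
        rw [← Finset.mul_sum]; simp only [hg]; ring
      simp only [hexpand]
      rw [intervalIntegral.integral_add, intervalIntegral.integral_const_mul,
        intervalIntegral.integral_const_mul, intervalIntegral.integral_finsetSum fun k _ ↦ hi k]
      · simp only [hterm, hg]
        rw [Finset.sum_range_succ' _ n]
        simp; ring
      · exact (IntervalIntegrable.sum (Finset.range n) fun k _ ↦ hi k).const_mul b |>.congr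
          (fun s _ ↦ by simp)
      · exact (hi n).const_mul K
  filter_upwards [ae_all_iff.2 hiter] with ω hω t ht
  have hlim : Filter.Tendsto
      (fun n : ℕ ↦ b * Real.exp (A t) + K * (A t ^ n / n.factorial)) Filter.atTop
      (nhds (b * Real.exp (A t) + K * 0)) :=
    ((FloorSemiring.tendsto_pow_div_factorial_atTop (A t)).const_mul K).const_add _
  rw [mul_zero, add_zero] at hlim
  refine ge_of_tendsto' hlim fun n ↦ (hω n t ht).trans ?_
  simp only [hg]
  gcongr
  exact Real.sum_le_exp_of_nonneg (hA0 ht) n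

/-! ### The difference of two solutions -/

variable {Ω : Type*} {mΩ : MeasurableSpace Ω} {P : Measure Ω}

/-- The norm `‖ρ_t‖_∞` of the density of `ρ_t = Law(Y_t)`, as a number: `0` if it is infinite. -/
noncomputable def lawDensity (P : Measure Ω) (Y : ℝ≥0 → Ω → E d) (t : ℝ) : ℝ≥0 :=
  (densityNorm (P.map (Y t.toNNReal))).toNNReal

theorem lawDensity_spec [IsProbabilityMeasure P] {T : ℝ≥0} {Y : ℝ≥0 → Ω → E d}
    (hY : ∀ t ≤ T, Measurable (Y t)) (hc : ∀ᵐ ω ∂P, ContinuousOn (fun t ↦ Y t ω) (Icc 0 T))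
    (hfin : densityNormL1 T (fun t ↦ P.map (Y t)) ≠ ∞) :
    IntervalIntegrable (fun t ↦ (lawDensity P Y t : ℝ)) volume 0 T ∧
      ∫ t in (0 : ℝ)..T, (lawDensity P Y t : ℝ)
        = (densityNormL1 T (fun t ↦ P.map (Y t))).toReal ∧
      ∀ᵐ t : ℝ, t ∈ Ioc (0 : ℝ) T → P.map (Y t.toNNReal) ≤ lawDensity P Y t • volume := by
  have hm := aemeasurable_densityNorm_map hY hc
  have hlt := ae_lt_top' hm hfin
  refine ⟨?_, ?_, ?_⟩
  · rw [intervalIntegrable_iff_integrableOn_Ioo_of_le T.coe_nonneg]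
    exact integrable_toReal_of_lintegral_ne_top hm hfin
  · rw [intervalIntegral.integral_of_le T.coe_nonneg, integral_Ioc_eq_integral_Ioo]
    exact integral_toReal hm hlt
  · rw [← ae_restrict_iff' measurableSet_Ioc, ← Measure.restrict_congr_set Ioo_ae_eq_Ioc]
    filter_upwards [hlt, ae_restrict_mem measurableSet_Ioo] with t ht htT
    have : IsProbabilityMeasure (P.map (Y t.toNNReal)) := Measure.isProbabilityMeasure_map
      (hY _ (Real.toNNReal_le_iff_le_coe.2 htT.2.le)).aemeasurable
    have h := le_densityNorm_smul_volume ht.ne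
    rwa [← ENNReal.coe_toNNReal ht.ne] at h

namespace IsSolution

variable {ℱ : Filtration ℝ≥0 mΩ} {B : ℝ≥0 → Ω → E d} {K K' : E d → E d} {σ : ℝ}
  {f₀ : Measure (E d × E d)} {T : ℝ≥0} {Y W Y' W' : ℝ≥0 → Ω → E d}

/-- As the noise is additive, it cancels in the difference of two solutions. -/
theorem ae_vel_sub_eq (h : IsSolution P ℱ B K σ f₀ T Y W) (h' : IsSolution P ℱ B K' σ f₀ T Y' W')
    (hinit : ∀ᵐ ω ∂P, Y' 0 ω = Y 0 ω ∧ W' 0 ω = W 0 ω) :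
    ∀ᵐ ω ∂P, ∀ t ≤ T, W' t ω - W t ω = ∫ s in (0 : ℝ)..t,
      (conv K' (P.map (Y' s.toNNReal)) (Y' s.toNNReal ω)
        - conv K (P.map (Y s.toNNReal)) (Y s.toNNReal ω)) := by
  filter_upwards [h.eq_vel, h'.eq_vel, hinit, h.integrable_drift, h'.integrable_drift]
    with ω e e' hω i i' t ht
  have hsub : uIcc (0 : ℝ) t ⊆ uIcc 0 T := by
    rw [uIcc_of_le t.coe_nonneg, uIcc_of_le T.coe_nonneg]
    exact Icc_subset_Icc_right (by exact_mod_cast ht)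
  rw [e t ht, e' t ht, hω.2, intervalIntegral.integral_sub (i'.mono_set hsub) (i.mono_set hsub)]
  abel

theorem intervalIntegrable_vel (h : IsSolution P ℱ B K σ f₀ T Y W) :
    ∀ᵐ ω ∂P, ∀ t ≤ T, IntervalIntegrable (fun s : ℝ ↦ W s.toNNReal ω) volume 0 t := by
  filter_upwards [h.continuous_vel] with ω hω t ht
  refine ContinuousOn.intervalIntegrable ?_
  rw [uIcc_of_le t.coe_nonneg]
  refine hω.comp (by fun_prop) fun s hs ↦ ⟨zero_le, ?_⟩
  exact (Real.toNNReal_le_iff_le_coe.2 hs.2).trans ht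

theorem ae_pos_sub_eq (h : IsSolution P ℱ B K σ f₀ T Y W) (h' : IsSolution P ℱ B K' σ f₀ T Y' W')
    (hinit : ∀ᵐ ω ∂P, Y' 0 ω = Y 0 ω ∧ W' 0 ω = W 0 ω) :
    ∀ᵐ ω ∂P, ∀ t ≤ T, Y' t ω - Y t ω
      = ∫ s in (0 : ℝ)..t, (W' s.toNNReal ω - W s.toNNReal ω) := by
  filter_upwards [h.eq_pos, h'.eq_pos, hinit, h.intervalIntegrable_vel, h'.intervalIntegrable_vel]
    with ω e e' hω i i' t ht
  rw [e t ht, e' t ht, hω.1, intervalIntegral.integral_sub (i' t ht) (i t ht)]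
  abel

theorem measurable_pos (h : IsSolution P ℱ B K σ f₀ T Y W) (t : ℝ≥0) (ht : t ≤ T) :
    Measurable (Y t) := (h.adapted_pos t ht).mono (ℱ.le t) le_rfl

end IsSolution

section Stability

variable [IsProbabilityMeasure P] {ℱ : Filtration ℝ≥0 mΩ} {B : ℝ≥0 → Ω → E d} {σ : ℝ}
  {f₀ : Measure (E d × E d)} {T : ℝ≥0} {Y W Y' W' : ℝ≥0 → Ω → E d} {ξ ε : ℝ}

/-- Since densities in `L^1(0,T;L^∞)` generate bounded fields, integrably in time, the difference of
the two solutions is bounded by a deterministic constant. -/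
theorem exists_ae_bound_sub (hd : 2 ≤ d) (hξ : |ξ| = 1)
    (h : IsSolution P ℱ B (force d ξ) σ f₀ T Y W)
    (h' : IsSolution P ℱ B (truncForce d ξ ε) σ f₀ T Y' W')
    (hinit : ∀ᵐ ω ∂P, Y' 0 ω = Y 0 ω ∧ W' 0 ω = W 0 ω)
    (hρ : densityNormL1 T (fun t ↦ P.map (Y t)) ≠ ∞)
    (hρ' : densityNormL1 T (fun t ↦ P.map (Y' t)) ≠ ∞) :
    ∃ R, ∀ᵐ ω ∂P, ∀ t ≤ T, ‖Y' t ω - Y t ω‖ ≤ R ∧ ‖W' t ω - W t ω‖ ≤ R := by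
  obtain ⟨hi, -, hs⟩ := lawDensity_spec h.measurable_pos h.continuous_pos hρ
  obtain ⟨hi', -, hs'⟩ := lawDensity_spec h'.measurable_pos h'.continuous_pos hρ'
  set u : ℝ → ℝ := fun s ↦ (1 + lawDensity P Y' s * sphereArea d)
    + (1 + lawDensity P Y s * sphereArea d) with hu
  have hu0 (s : ℝ) : 0 ≤ u s := by have := sphereArea_nonneg (d := d); positivity
  have hui : IntervalIntegrable u volume 0 T :=
    (intervalIntegrable_const.add (hi'.mul_const _)).add (intervalIntegrable_const.add
      (hi.mul_const _))
  have hV : ∀ᵐ ω ∂P, ∀ t ≤ T, ‖W' t ω - W t ω‖ ≤ ∫ s in (0 : ℝ)..T, u s := by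
    filter_upwards [h.ae_vel_sub_eq h' hinit] with ω hω t ht
    have ht' : (t : ℝ) ≤ T := by exact_mod_cast ht
    rw [hω t ht]
    refine (intervalIntegral.norm_integral_le_of_norm_le t.coe_nonneg (g := u) ?_
      (hui.mono_set (by rw [uIcc_of_le t.coe_nonneg, uIcc_of_le T.coe_nonneg]; exact Icc_subset_Icc_right ht'))).trans
      (intervalIntegral.integral_mono_interval le_rfl t.coe_nonneg ht' (ae_of_all _ hu0) hui)
    filter_upwards [hs, hs'] with s hs hs' hst
    have hsT : s ∈ Ioc (0 : ℝ) T := ⟨hst.1, hst.2.trans ht'⟩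
    have hsT' : s.toNNReal ≤ T := Real.toNNReal_le_iff_le_coe.2 hsT.2
    have : IsProbabilityMeasure (P.map (Y s.toNNReal)) :=
      Measure.isProbabilityMeasure_map (h.measurable_pos _ hsT').aemeasurable
    have : IsProbabilityMeasure (P.map (Y' s.toNNReal)) :=
      Measure.isProbabilityMeasure_map (h'.measurable_pos _ hsT').aemeasurable
    exact (norm_sub_le _ _).trans (add_le_add
      (integrable_and_norm_conv_le hd (hs' hsT) (measurable_truncForce ξ ε)
        (norm_truncForce_le hd hξ) _).2
      (integrable_and_norm_conv_le hd (hs hsT) (measurable_force ξ) (norm_force_le hd hξ) _).2)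
  set R := ∫ s in (0 : ℝ)..T, u s
  have hR : 0 ≤ R := intervalIntegral.integral_nonneg T.coe_nonneg fun s _ ↦ hu0 s
  refine ⟨(1 + T) * R, ?_⟩
  filter_upwards [hV, h.ae_pos_sub_eq h' hinit] with ω hω hpos t ht
  have ht' : (t : ℝ) ≤ T := by exact_mod_cast ht
  have hTR : 0 ≤ T * R := by positivity
  refine ⟨?_, (hω t ht).trans (by linarith)⟩
  rw [hpos t ht]
  refine (intervalIntegral.norm_integral_le_of_norm_le_const (C := R) fun s hs ↦ ?_).trans ?_
  · rw [uIoc_of_le t.coe_nonneg] at hs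
    exact hω _ (Real.toNNReal_le_iff_le_coe.2 (hs.2.trans ht'))
  · rw [sub_zero, abs_of_nonneg t.coe_nonneg]
    nlinarith

/-- The growth rate of the weighted difference of the two solutions, divided by `ℓ = √(log N)`, when
`c`, `c'` are the norms of their densities. The summand `1` is the contribution of the positions. -/
noncomputable def growthRate (d : ℕ) (δ c c' : ℝ) : ℝ :=
  2 * (d + 1) * (2 + (c + c') * (sphereArea d * (1 + δ))) + 1

theorem growthRate_nonneg {δ c c' : ℝ} (hδ : 0 ≤ δ) (hc : 0 ≤ c) (hc' : 0 ≤ c') :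
    0 ≤ growthRate d δ c c' := by
  have := sphereArea_nonneg (d := d)
  unfold growthRate
  positivity

/-- The weight `ℓ = √(log N)` on the positions balances the rate `1` at which the velocities drive
the positions and the rate `ℓ²` of the Lipschitz constant of the field: the weighted difference
grows at the rate `ℓ` only. -/
theorem ae_weighted_sub_le (hd : 2 ≤ d) (hξ : |ξ| = 1) (hε : 0 < ε) (hε1 : ε ≤ 1) {δ ℓ : ℝ}
    (hδ : 0 ≤ δ) (hℓ : 1 ≤ ℓ) (hlog : Real.log ε⁻¹ = δ * ℓ ^ 2)
    (h : IsSolution P ℱ B (force d ξ) σ f₀ T Y W)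
    (h' : IsSolution P ℱ B (truncForce d ξ ε) σ f₀ T Y' W')
    (hinit : ∀ᵐ ω ∂P, Y' 0 ω = Y 0 ω ∧ W' 0 ω = W 0 ω)
    (hρ : densityNormL1 T (fun t ↦ P.map (Y t)) ≠ ∞)
    (hρ' : densityNormL1 T (fun t ↦ P.map (Y' t)) ≠ ∞) :
    ∀ᵐ ω ∂P, ∀ t ≤ T, ℓ * ‖Y' t ω - Y t ω‖ + ‖W' t ω - W t ω‖
      ≤ sphereArea d * ε * (∫ s in (0 : ℝ)..T, (lawDensity P Y s : ℝ))
        * Real.exp (ℓ * ∫ s in (0 : ℝ)..T,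
          growthRate d δ (lawDensity P Y s) (lawDensity P Y' s)) := by
  obtain ⟨hi, -, hs⟩ := lawDensity_spec h.measurable_pos h.continuous_pos hρ
  obtain ⟨hi', -, hs'⟩ := lawDensity_spec h'.measurable_pos h'.continuous_pos hρ'
  have hκ := sphereArea_nonneg (d := d)
  have hℓ0 : 0 < ℓ := by linarith
  set α : ℝ → ℝ := fun s ↦ growthRate d δ (lawDensity P Y s) (lawDensity P Y' s) with hα
  have hα0 (s : ℝ) : 0 ≤ α s := growthRate_nonneg hδ (by positivity) (by positivity)
  have hαi : IntervalIntegrable α volume 0 T :=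
    ((intervalIntegrable_const.add ((hi.add hi').mul_const _)).const_mul _).add
      intervalIntegrable_const
  have hai : IntervalIntegrable (fun s ↦ ℓ * α s) volume 0 T := hαi.const_mul ℓ
  have hsub {t : ℝ} (ht : t ∈ Icc (0 : ℝ) T) : uIcc 0 t ⊆ uIcc (0 : ℝ) T := by
    rw [uIcc_of_le ht.1, uIcc_of_le T.coe_nonneg]; exact Icc_subset_Icc_right ht.2
  set b := sphereArea d * ε * ∫ s in (0 : ℝ)..T, (lawDensity P Y s : ℝ) with hb
  have hb0 : 0 ≤ b := mul_nonneg (by positivity)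
    (intervalIntegral.integral_nonneg T.coe_nonneg fun s _ ↦ NNReal.coe_nonneg _)
  obtain ⟨R, hR⟩ := exists_ae_bound_sub hd hξ h h' hinit hρ hρ'
  have hgron := ae_le_mul_exp_of_forall_bound (P := P) (T := T)
    (Z := fun t ω ↦ ℓ * ‖Y' t.toNNReal ω - Y t.toNNReal ω‖ + ‖W' t.toNNReal ω - W t.toNNReal ω‖)
    hai (fun s ↦ mul_nonneg hℓ0.le (hα0 s)) (b := b) (K := ℓ * R + R) hb0 ?_ ?_
  · filter_upwards [hgron] with ω hω t ht
    have htT : (t : ℝ) ∈ Icc (0 : ℝ) T := ⟨t.coe_nonneg, by exact_mod_cast ht⟩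
    have := hω t htT
    rw [Real.toNNReal_coe] at this
    refine this.trans ?_
    rw [← intervalIntegral.integral_const_mul]
    gcongr
    exact intervalIntegral.integral_mono_interval le_rfl t.coe_nonneg htT.2
      (ae_of_all _ fun s ↦ mul_nonneg hℓ0.le (hα0 s)) hai
  · filter_upwards [hR] with ω hω t ht
    have := hω t.toNNReal (Real.toNNReal_le_iff_le_coe.2 ht.2)
    gcongr
    exacts [this.1, this.2]
  · intro g hgc hZg
    filter_upwards [hZg, h.ae_vel_sub_eq h' hinit, h.ae_pos_sub_eq h' hinit]
      with ω hω hvel hpos t ht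
    have htT : t.toNNReal ≤ T := Real.toNNReal_le_iff_le_coe.2 ht.2
    have htc : (t.toNNReal : ℝ) = t := Real.coe_toNNReal _ ht.1
    have hgct : ContinuousOn g (uIcc 0 t) := by
      rw [uIcc_of_le ht.1]; exact hgc.mono (Icc_subset_Icc_right ht.2)
    have hgi : IntervalIntegrable g volume 0 t := hgct.intervalIntegrable
    have hvi : IntervalIntegrable (fun s ↦ ℓ * ((α s - 1) * g s)
        + sphereArea d * ε * lawDensity P Y s) volume 0 t :=
      ((((hαi.mono_set (hsub ht)).sub intervalIntegrable_const).mul_continuousOn hgct).const_mul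
        ℓ).add ((hi.mono_set (hsub ht)).const_mul _)
    have hV : ‖W' t.toNNReal ω - W t.toNNReal ω‖
        ≤ ∫ s in (0 : ℝ)..t, (ℓ * ((α s - 1) * g s) + sphereArea d * ε * lawDensity P Y s) := by
      rw [hvel _ htT, htc]
      refine intervalIntegral.norm_integral_le_of_norm_le ht.1 ?_ hvi
      filter_upwards [hs, hs'] with s hs hs' hst
      have hsT : s ∈ Ioc (0 : ℝ) T := ⟨hst.1, hst.2.trans ht.2⟩
      have hsT' : s.toNNReal ≤ T := Real.toNNReal_le_iff_le_coe.2 hsT.2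
      have hG {ω' : Ω} (hω' : ∀ t ∈ Icc (0 : ℝ) T, ℓ * ‖Y' t.toNNReal ω' - Y t.toNNReal ω'‖
          + ‖W' t.toNNReal ω' - W t.toNNReal ω'‖ ≤ g t) :
          ‖Y' s.toNNReal ω' - Y s.toNNReal ω'‖ ≤ g s / ℓ := by
        rw [le_div_iff₀ hℓ0, mul_comm]
        have := hω' s ⟨hsT.1.le, hsT.2⟩
        have := norm_nonneg (W' s.toNNReal ω' - W s.toNNReal ω')
        linarith
      have hgs : 0 ≤ g s / ℓ := (norm_nonneg _).trans (hG hω)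
      refine (norm_conv_truncForce_sub_conv_force_le_of_coupling hd hξ hε hε1
        (h.measurable_pos _ hsT') (h'.measurable_pos _ hsT') (hs hsT) (hs' hsT)
        (hZg.mono fun ω' ↦ hG) (hG hω)).trans ?_
      refine add_le_add ?_ (le_of_eq (by ring))
      -- this is where `1 ≤ ℓ` enters: the logarithm `ℓ²` absorbs the bounded part of the rate
      have hle : 2 + ((lawDensity P Y s : ℝ) + lawDensity P Y' s)
          * (sphereArea d * (1 + Real.log ε⁻¹)) ≤ ℓ ^ 2 *
          (2 + ((lawDensity P Y s : ℝ) + lawDensity P Y' s) * (sphereArea d * (1 + δ))) := by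
        have h1 : 1 ≤ ℓ ^ 2 := one_le_pow₀ hℓ
        have h2 : 0 ≤ ((lawDensity P Y s : ℝ) + lawDensity P Y' s) * sphereArea d := by positivity
        rw [hlog]
        nlinarith
      calc _ ≤ (d + 1) * (ℓ ^ 2 * (2 + ((lawDensity P Y s : ℝ) + lawDensity P Y' s)
            * (sphereArea d * (1 + δ)))) * (2 * (g s / ℓ)) := by gcongr
        _ = ℓ * ((α s - 1) * g s) := by simp only [hα, growthRate]; field_simp; ring
    have hX : ℓ * ‖Y' t.toNNReal ω - Y t.toNNReal ω‖ ≤ ∫ s in (0 : ℝ)..t, ℓ * g s := by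
      rw [intervalIntegral.integral_const_mul, hpos _ htT, htc]
      gcongr
      refine intervalIntegral.norm_integral_le_of_norm_le ht.1 (ae_of_all _ fun s hst ↦ ?_) hgi
      have := hω s ⟨hst.1.le, hst.2.trans ht.2⟩
      have : 0 ≤ ℓ * ‖Y' s.toNNReal ω - Y s.toNNReal ω‖ := by positivity
      linarith
    have hmass : ∫ s in (0 : ℝ)..t, sphereArea d * ε * (lawDensity P Y s : ℝ) ≤ b := by
      rw [intervalIntegral.integral_const_mul]
      exact mul_le_mul_of_nonneg_left (intervalIntegral.integral_mono_interval le_rfl ht.1 ht.2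
        (ae_of_all _ fun s ↦ NNReal.coe_nonneg _) hi) (by positivity)
    calc ℓ * ‖Y' t.toNNReal ω - Y t.toNNReal ω‖ + ‖W' t.toNNReal ω - W t.toNNReal ω‖
        ≤ (∫ s in (0 : ℝ)..t, ℓ * g s) + ∫ s in (0 : ℝ)..t,
          (ℓ * ((α s - 1) * g s) + sphereArea d * ε * lawDensity P Y s) := add_le_add hX hV
      _ = (∫ s in (0 : ℝ)..t, sphereArea d * ε * (lawDensity P Y s : ℝ))
          + ∫ s in (0 : ℝ)..t, ℓ * α s * g s := by
        rw [← intervalIntegral.integral_add (hgi.const_mul ℓ) hvi,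
          ← intervalIntegral.integral_add ((hi.mono_set (hsub ht)).const_mul _)
            ((hai.mono_set (hsub ht)).mul_continuousOn hgct)]
        congr 1; ext s; ring
      _ ≤ b + ∫ s in (0 : ℝ)..t, ℓ * α s * g s := by gcongr

/-- Integrated in time, the growth rate is bounded independently of the truncation. -/
theorem integral_growthRate_le {δ : ℝ} (hδ : 0 ≤ δ)
    (hY : ∀ t ≤ T, Measurable (Y t)) (hc : ∀ᵐ ω ∂P, ContinuousOn (fun t ↦ Y t ω) (Icc 0 T))
    (hY' : ∀ t ≤ T, Measurable (Y' t)) (hc' : ∀ᵐ ω ∂P, ContinuousOn (fun t ↦ Y' t ω) (Icc 0 T))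
    {m M : ℝ≥0} (hρ : densityNormL1 T (fun t ↦ P.map (Y t)) ≤ m)
    (hρ' : densityNormL1 T (fun t ↦ P.map (Y' t)) ≤ M) :
    ∫ s in (0 : ℝ)..T, growthRate d δ (lawDensity P Y s) (lawDensity P Y' s)
      ≤ 2 * (d + 1) * (2 * T + (m + M) * (sphereArea d * (1 + δ))) + T := by
  obtain ⟨hi, he, -⟩ := lawDensity_spec hY hc (ne_top_of_le_ne_top ENNReal.coe_ne_top hρ)
  obtain ⟨hi', he', -⟩ := lawDensity_spec hY' hc' (ne_top_of_le_ne_top ENNReal.coe_ne_top hρ')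
  have hm := ENNReal.toReal_mono ENNReal.coe_ne_top hρ
  have hM := ENNReal.toReal_mono ENNReal.coe_ne_top hρ'
  rw [← he, ENNReal.coe_toReal] at hm
  rw [← he', ENNReal.coe_toReal] at hM
  have hκ := sphereArea_nonneg (d := d)
  have hsum := (hi.add hi').mul_const (sphereArea d * (1 + δ))
  unfold growthRate
  rw [intervalIntegral.integral_add ((intervalIntegrable_const.add hsum).const_mul _)
      intervalIntegrable_const, intervalIntegral.integral_const_mul,
    intervalIntegral.integral_add intervalIntegrable_const hsum,
    intervalIntegral.integral_mul_const, intervalIntegral.integral_add hi hi',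
    intervalIntegral.integral_const, intervalIntegral.integral_const]
  simp only [sub_zero, smul_eq_mul, mul_one]
  rw [mul_comm (T : ℝ) 2]
  gcongr

end Stability

/-- A deterministic bound for a process bounds all the moments of its supremum. -/
theorem lintegral_iSup_rpow_rpow_le {Ω ι : Type*} {mΩ : MeasurableSpace Ω} {P : Measure Ω}
    [IsProbabilityMeasure P] {S : Set ι} {Z : ι → Ω → ℝ≥0∞} {R : ℝ≥0∞}
    (h : ∀ᵐ ω ∂P, ∀ t ∈ S, Z t ω ≤ R) {p : ℝ} (hp : 0 < p) :
    (∫⁻ ω, ⨆ t ∈ S, Z t ω ^ p ∂P) ^ (1 / p) ≤ R := by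
  have hle : ∫⁻ ω, ⨆ t ∈ S, Z t ω ^ p ∂P ≤ R ^ p := by
    refine (lintegral_mono_ae (g := fun _ ↦ R ^ p) ?_).trans (by simp)
    filter_upwards [h] with ω hω
    exact iSup₂_le fun t ht ↦ ENNReal.rpow_le_rpow (hω t ht) hp.le
  refine (ENNReal.rpow_le_rpow hle (by positivity)).trans_eq ?_
  rw [one_div, ENNReal.rpow_rpow_inv hp.ne']

end VPFP

theorem mainTheorem5
    (d : ℕ) (hd : 2 ≤ d) (ξ : ℝ) (hξ : ξ = 1 ∨ ξ = -1) (σ : ℝ) (hσ : 0 < σ)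
    (δ : ℝ) (hδ : 0 < δ) (T : ℝ≥0) (hT : 0 < T)
    {Ω : Type*} {mΩ : MeasurableSpace Ω} (P : Measure Ω) [IsProbabilityMeasure P]
    (ℱ : Filtration ℝ≥0 mΩ) (B : ℝ≥0 → Ω → VPFP.E d) (hB : VPFP.IsBrownianMotion P ℱ B)
    (f₀ : Measure (VPFP.E d × VPFP.E d))
    -- the solution of the nonlinear SDE
    (Y W : ℝ≥0 → Ω → VPFP.E d)
    (hYW : VPFP.IsSolution P ℱ B (VPFP.force d ξ) σ f₀ T Y W)
    -- the solutions of the nonlinear SDE with cut-off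
    (YN WN : ℕ → ℝ≥0 → Ω → VPFP.E d)
    (hYWN : ∀ N : ℕ, Real.exp 1 ≤ N →
      VPFP.IsSolution P ℱ B (VPFP.cutoffForce d ξ δ N) σ f₀ T (YN N) (WN N))
    -- the same initial condition
    (hinit : ∀ N : ℕ, Real.exp 1 ≤ N → ∀ᵐ ω ∂P, YN N 0 ω = Y 0 ω ∧ WN N 0 ω = W 0 ω)
    -- the bounds on the spatial densities
    (hρ : VPFP.densityNormL1 T (fun t ↦ P.map (Y t)) < ∞)
    (M : ℝ≥0)
    (hρN : ∀ N : ℕ, Real.exp 1 ≤ N → VPFP.densityNormL1 T (fun t ↦ P.map (YN N t)) ≤ M) :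
    ∃ C : ℝ, 0 < C ∧ ∀ N : ℕ, Real.exp 1 ≤ N → ∀ p : ℝ, 1 ≤ p →
      (∫⁻ ω, ⨆ t ∈ Icc (0 : ℝ≥0) T,
          ENNReal.ofReal (√(Real.log N) * ‖YN N t ω - Y t ω‖ + ‖WN N t ω - W t ω‖) ^ p ∂P) ^ (1 / p)
        ≤ ENNReal.ofReal (C * (N : ℝ) ^ (-δ) * Real.exp (C * √(Real.log N))) := by
  have hξ' : |ξ| = 1 := by rcases hξ with rfl | rfl <;> simp
  have hκ := VPFP.sphereArea_nonneg (d := d)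
  -- `m` is the norm of `ρ`, and `A` bounds the integral of the growth rate for every `N`
  lift VPFP.densityNormL1 T (fun t ↦ P.map (Y t)) to ℝ≥0 using hρ.ne with m hm
  set A : ℝ := 2 * (d + 1) * (2 * T + (m + M) * (VPFP.sphereArea d * (1 + δ))) + T with hA
  have hA0 : 0 ≤ A := by positivity
  refine ⟨VPFP.sphereArea d * m + A + 1, by positivity, fun N hN p hp ↦ ?_⟩
  have hN0 : (0 : ℝ) < N := (Real.exp_pos 1).trans_le hN
  have hlogN : 1 ≤ Real.log N := (Real.le_log_iff_exp_le hN0).2 hN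
  have hε : 0 < (N : ℝ) ^ (-δ) := Real.rpow_pos_of_pos hN0 _
  have hε1 : (N : ℝ) ^ (-δ) ≤ 1 :=
    Real.rpow_le_one_of_one_le_of_nonpos ((Real.one_le_exp zero_le_one).trans hN) (by linarith)
  have hlog : Real.log ((N : ℝ) ^ (-δ))⁻¹ = δ * √(Real.log N) ^ 2 := by
    rw [Real.log_inv, Real.log_rpow hN0, Real.sq_sqrt (by linarith)]
    ring
  have hρ' := ne_top_of_le_ne_top ENNReal.coe_ne_top (hρN N hN)
  have hmfin : VPFP.densityNormL1 T (fun t ↦ P.map (Y t)) ≠ ∞ := hm ▸ ENNReal.coe_ne_top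
  have hYm := hYW.measurable_pos
  have hYNm := (hYWN N hN).measurable_pos
  have hmain := VPFP.ae_weighted_sub_le (ε := (N : ℝ) ^ (-δ)) hd hξ' hε hε1 hδ.le
    (Real.one_le_sqrt.2 hlogN) hlog hYW (hYWN N hN) (hinit N hN) hmfin hρ'
  have hmass := (VPFP.lawDensity_spec hYm hYW.continuous_pos hmfin).2.1
  have hrate := VPFP.integral_growthRate_le hδ.le hYm hYW.continuous_pos hYNm
    (hYWN N hN).continuous_pos hm.ge (hρN N hN)
  rw [hmass, ← hm, ENNReal.coe_toReal] at hmain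
  refine VPFP.lintegral_iSup_rpow_rpow_le ?_ (zero_lt_one.trans_le hp)
  filter_upwards [hmain] with ω hω t ht
  refine ENNReal.ofReal_le_ofReal ((hω t ht.2).trans ?_)
  have hm0 : 0 ≤ VPFP.sphereArea d * m := by positivity
  calc VPFP.sphereArea d * (N : ℝ) ^ (-δ) * m * Real.exp (√(Real.log N) * _)
      ≤ VPFP.sphereArea d * (N : ℝ) ^ (-δ) * m * Real.exp (√(Real.log N) * A) := by gcongr
    _ = VPFP.sphereArea d * m * (N : ℝ) ^ (-δ) * Real.exp (A * √(Real.log N)) := by ring_nf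
    _ ≤ _ := by gcongr <;> linarith
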